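/- All rings are associative and unital. A topological ring $\mathfrak R$ is \emph{two-sided linear} if its open two-sided ideals form a base of neighborhoods of zero; it is \emph{complete and separated} if the natural map $\mathfrak R\to\varprojlim_{U}\mathfrak R/U$ (over the open subgroups $U$) is bijective. For a complete, separated two-sided linear topological ring $\mathfrak R$ and a set $X$, let $\mathfrak R[[X]]$ be the set of infinite formal linear combinations $\sum_{x\in X}r_xx$ whose families of coefficients converge to zero in $\mathfrak R$ (every open subgroup contains all but finitely many $r_x$). With the unit $x\mapsto 1\cdot x$, with push-forward along maps $X\to Y$ given by (infinite) summation of coefficients over the fibers, and with the multiplication $\mathfrak R[[\mathfrak R[[X]]]]\to\mathfrak R[[X]]$ given by opening the parentheses, $X\mapsto\mathfrak R[[X]]$ is a monad on the category of sets. The category $\mathfrak R\text{-Contra}$ of \emph{left $\mathfrak R$-contramodules} is the category of algebras over this monad; restricting the contraaction map $\pi_{\mathfrak P}\colon\mathfrak R[[\mathfrak P]]\to\mathfrak P$ to finite formal linear combinations defines the forgetful functor $\mathfrak R\text{-Contra}\to\mathfrak R\text{-Mod}$ to left $\mathfrak R$-modules. For an open right ideal $\mathfrak I\subset\mathfrak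 R$, let $\mathfrak I\rightthreetimes\mathfrak P\subset\mathfrak P$ be the image under $\pi_{\mathfrak P}$ of the formal linear combinations with all coefficients in $\mathfrak I$. A contramodule $\mathfrak P$ is \emph{separated} if $\bigcap_{\mathfrak I}(\mathfrak I\rightthreetimes\mathfrak P)=0$, where $\mathfrak I$ ranges over the open right ideals; $\mathfrak R\text{-Separ}\subset\mathfrak R\text{-Contra}$ is the full subcategory of separated contramodules. A continuous ring homomorphism $\mathfrak f\colon\mathfrak R\to\mathfrak S$ induces restriction-of-scalars functors $\mathfrak f_\sharp\colon\mathfrak S\text{-Separ}\to\mathfrak R\text{-Separ}$ and $\mathfrak f_*\colon\mathfrak S\text{-Mod}\to\mathfrak R\text{-Mod}$. The map $\mathfrak f$ is \emph{strongly right taut} if those open two-sided ideals $\mathfrak I\subset\mathfrak R$ for which the closure of the right ideal $\mathfrak f(\mathfrak I)\mathfrak S\subset\mathfrak S$ is an open two-sided ideal of $\mathfrak S$ form a base of neighborhoods of zero in $\mathfrak R$. \textbf{Proposition.} Let $\mathfrak R$ and $\mathfrak S$ be complete, separated two-sided linear topological rings with countable bases of neighborhoods of zero, and let $\mathfrak f\colon\mathfrak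 R\to\mathfrak S$ be a strongly right taut continuous ring homomorphism. Assume that the forgetful functor $\mathfrak R\text{-Contra}\to\mathfrak R\text{-Mod}$ is fully faithful. Then the commutative square of forgetful functors $$ \begin{array}{ccc} \mathfrak S\text{-Separ}&\longrightarrow&\mathfrak S\text{-Mod}\\ {\scriptstyle\mathfrak f_\sharp}\downarrow&&\downarrow{\scriptstyle\mathfrak f_*}\\ \mathfrak R\text{-Separ}&\longrightarrow&\mathfrak R\text{-Mod} \end{array} $$ (commuting up to the natural isomorphism given by the identity maps on underlying sets) is a pseudopullback diagram: the comparison functor from $\mathfrak S\text{-Separ}$ to the category of triples $(M,\mathfrak P,\phi)$, with $M\in\mathfrak S\text{-Mod}$, $\mathfrak P\in\mathfrak R\text{-Separ}$ and $\phi$ an isomorphism between the underlying $\mathfrak R$-modules of $M$ and $\mathfrak P$, is an equivalence of categories. Both horizontal functors in the square are fully faithful. Consequently, the forgetful functor $\mathfrak S\text{-Contra}\to\mathfrak S\text{-Mod}$ is fully faithful, too. -/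

import Mathlib

open CategoryTheory Filter Topology

universe u v w

set_option linter.unusedSectionVars false

/-! ### Infinite formal linear combinations -/

section FormalSums

/-- `R[[X]]`: the formal linear combinations `∑ aₓ x` of elements of `X` whose coefficient
family `X → R` converges to zero, i.e. all but finitely many coefficients lie in any given
neighbourhood of zero.  It is a left `R`-submodule of `X → R`. -/
def zeroConvergent (R : Type u) [Ring R] [TopologicalSpace R] [IsTopologicalRing R]
    (X : Type v) : Submodule R (X → R) where
  carrier := {a | Tendsto a cofinite (𝓝 0)}
  add_mem' {a b} ha hb := by
    have h := Tendsto.add (f := a) (g := b) ha hb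
    rw [add_zero] at h
    exact h
  zero_mem' := tendsto_const_nhds
  smul_mem' r a ha := by
    have h := Tendsto.const_mul (f := a) r ha
    rw [mul_zero] at h
    exact h

/-- The type `R[[X]]`. -/
abbrev FormalSum (R : Type u) [Ring R] [TopologicalSpace R] [IsTopologicalRing R]
    (X : Type v) : Type (max u v) := zeroConvergent R X

variable {R : Type u} [Ring R] [UniformSpace R] [IsUniformAddGroup R] [IsTopologicalRing R]

theorem nonarchimedean_of_rightLinear [IsLinearTopology Rᵐᵒᵖ R] : NonarchimedeanAddGroup R where
  is_nonarchimedean U hU := by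
    obtain ⟨I, hI, hIU⟩ := (IsLinearTopology.hasBasis_open_submodule Rᵐᵒᵖ).mem_iff.1 hU
    exact ⟨⟨I.toAddSubgroup, hI⟩, hIU⟩

variable {X : Type v} {Y : Type w}

theorem summable_of_zeroConvergent [IsLinearTopology Rᵐᵒᵖ R] [CompleteSpace R] {a : X → R}
    (ha : Tendsto a cofinite (𝓝 0)) : Summable a :=
  haveI : NonarchimedeanAddGroup R := nonarchimedean_of_rightLinear
  NonarchimedeanAddGroup.summable_of_tendsto_cofinite_zero ha

theorem tendsto_mul_right_zero [IsLinearTopology Rᵐᵒᵖ R] {a : X → R}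
    (ha : Tendsto a cofinite (𝓝 0)) (b : X → R) :
    Tendsto (fun x => a x * b x) cofinite (𝓝 0) :=
  IsLinearTopology.tendsto_mul_zero_of_left a b ha

theorem tsum_mem_of_isOpen [IsLinearTopology Rᵐᵒᵖ R] {a : X → R} (I : Submodule Rᵐᵒᵖ R)
    (hI : IsOpen (I : Set R)) (h : ∀ x, a x ∈ I) : ∑' x, a x ∈ I := by
  have hc : IsClosed (I : Set R) := I.toAddSubgroup.isClosed_of_isOpen hI
  by_cases hs : Summable a
  · exact hc.mem_of_tendsto hs.hasSum (Eventually.of_forall fun s => I.sum_mem fun i _ => h i)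
  · rw [tsum_eq_zero_of_not_summable hs]
    exact I.zero_mem

/-- A family `(x, y) ↦ aₓ b_{x,y}` with `a` zero-convergent and each `b_x` zero-convergent is
zero-convergent. -/
theorem tendsto_mul_prod_zero [IsLinearTopology Rᵐᵒᵖ R] {a : X → R}
    (ha : Tendsto a cofinite (𝓝 0)) {b : X → Y → R}
    (hb : ∀ x, Tendsto (b x) cofinite (𝓝 0)) :
    Tendsto (fun p : X × Y => a p.1 * b p.1 p.2) cofinite (𝓝 0) := by
  refine (IsLinearTopology.hasBasis_open_submodule Rᵐᵒᵖ).tendsto_right_iff.2 fun I hI => ?_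
  have hI0 : (I : Set R) ∈ 𝓝 (0 : R) := hI.mem_nhds I.zero_mem
  have h1 : {x | a x ∉ I}.Finite := ha.eventually hI0
  have h2 : ∀ x, {y | a x * b x y ∉ I}.Finite := fun x => by
    have h := Tendsto.const_mul (a x) (hb x)
    rw [mul_zero] at h
    exact h.eventually hI0
  refine ((h1.biUnion fun x _ => (h2 x).image fun y => (x, y))).subset ?_
  rintro ⟨x, y⟩ hxy
  have hxy' : a x * b x y ∉ I := hxy
  simp only [Set.mem_iUnion, Set.mem_image, Set.mem_ofPred_eq]
  exact ⟨x, fun hx => hxy' (I.smul_mem (MulOpposite.op (b x y)) hx), y, hxy', rfl⟩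

theorem tendsto_tsum_snd_zero [IsLinearTopology Rᵐᵒᵖ R] {c : X × Y → R}
    (hc : Tendsto c cofinite (𝓝 0)) :
    Tendsto (fun y => ∑' x, c (x, y)) cofinite (𝓝 0) := by
  refine (IsLinearTopology.hasBasis_open_submodule Rᵐᵒᵖ).tendsto_right_iff.2 fun I hI => ?_
  have h1 : {p | c p ∉ I}.Finite := hc.eventually (hI.mem_nhds I.zero_mem)
  refine (h1.image Prod.snd).subset fun y hy => ?_
  by_contra hcon
  refine hy (tsum_mem_of_isOpen I hI fun x => ?_)
  by_contra hx
  exact hcon ⟨(x, y), hx, rfl⟩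

namespace FormalSum

open Classical in
/-- The map `X → R[[X]]` sending `x` to the formal linear combination `1 · x`. -/
noncomputable def single (x : X) : FormalSum R X :=
  ⟨Pi.single x 1, by
    refine Tendsto.congr' ?_ tendsto_const_nhds
    refine (Set.finite_singleton x).subset fun y hy => ?_
    by_contra hne
    exact hy (Pi.single_eq_of_ne (M := fun _ : X => R) hne 1).symm⟩

variable [IsLinearTopology Rᵐᵒᵖ R]

/-- The map `R[[X]] → R[[Y]]` induced by `f : X → Y`, which sends `∑ aₓ x` to `∑ b_y y` with
`b_y = ∑_{f x = y} aₓ`, the infinite sum being taken in the topology of `R`. -/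
noncomputable def map (f : X → Y) (a : FormalSum R X) : FormalSum R Y :=
  ⟨fun y => ∑' x : f ⁻¹' {y}, a.1 x, by
    refine (IsLinearTopology.hasBasis_open_submodule Rᵐᵒᵖ).tendsto_right_iff.2 fun I hI => ?_
    have h1 : {x | a.1 x ∉ I}.Finite := Tendsto.eventually a.2 (hI.mem_nhds I.zero_mem)
    refine (h1.image f).subset fun y hy => ?_
    by_contra hcon
    refine hy (tsum_mem_of_isOpen I hI fun x => ?_)
    by_contra hx
    exact hcon ⟨x.1, hx, x.2⟩⟩

/-- Opening of parentheses, `R[[R[[X]]]] → R[[X]]`: the coefficient of `x` in `∑ zₐ a` is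
`∑ₐ zₐ aₓ`. -/
noncomputable def join (z : FormalSum R (FormalSum R X)) : FormalSum R X :=
  ⟨fun x => ∑' a : FormalSum R X, z.1 a * a.1 x,
    tendsto_tsum_snd_zero (c := fun p : FormalSum R X × X => z.1 p.1 * p.1.1 p.2)
      (tendsto_mul_prod_zero z.2 fun a => a.2)⟩

/-- Substitution of formal linear combinations `g x` for the elements `x` in `∑ aₓ x`. -/
noncomputable def bind (a : FormalSum R X) (g : X → FormalSum R Y) : FormalSum R Y :=
  ⟨fun y => ∑' x, a.1 x * (g x).1 y,
    tendsto_tsum_snd_zero (c := fun p : X × Y => a.1 p.1 * (g p.1).1 p.2)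
      (tendsto_mul_prod_zero a.2 fun x => (g x).2)⟩

theorem join_eq (z : FormalSum R (FormalSum R X)) : join z = bind z id := rfl

theorem map_eq (f : X → Y) (a : FormalSum R X) :
    map f a = bind a fun x => single (f x) := by
  classical
  ext y
  change ∑' x : f ⁻¹' {y}, a.1 x = ∑' x, a.1 x * (Pi.single (f x) (1 : R) : Y → R) y
  rw [tsum_subtype]
  refine tsum_congr fun x => ?_
  by_cases h : f x = y
  · rw [Set.indicator_of_mem (show x ∈ f ⁻¹' {y} from h), h, Pi.single_eq_same, mul_one]
  · rw [Set.indicator_of_notMem (show x ∉ f ⁻¹' {y} from h), Pi.single_eq_of_ne (Ne.symm h),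
      mul_zero]

variable [T2Space R]

theorem single_bind (x : X) (g : X → FormalSum R Y) : bind (single x) g = g x := by
  classical
  ext y
  change ∑' x', (Pi.single x (1 : R) : X → R) x' * (g x').1 y = (g x).1 y
  rw [tsum_eq_single x fun x' h => by rw [Pi.single_eq_of_ne h, zero_mul], Pi.single_eq_same,
    one_mul]

theorem bind_single (a : FormalSum R X) : bind a single = a := by
  classical
  ext y
  change ∑' x, a.1 x * (Pi.single x (1 : R) : X → R) y = a.1 y
  rw [tsum_eq_single y fun x h => by rw [Pi.single_eq_of_ne (Ne.symm h), mul_zero],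
    Pi.single_eq_same, mul_one]

variable [CompleteSpace R]

theorem bind_bind {Z : Type*} (a : FormalSum R X) (g : X → FormalSum R Y)
    (h : Y → FormalSum R Z) : bind (bind a g) h = bind a fun x => bind (g x) h := by
  ext t
  change ∑' y, (∑' x, a.1 x * (g x).1 y) * (h y).1 t
    = ∑' x, a.1 x * ∑' y, (g x).1 y * (h y).1 t
  have hs : Summable (Function.uncurry fun x y => a.1 x * ((g x).1 y * (h y).1 t)) :=
    summable_of_zeroConvergent (tendsto_mul_prod_zero a.2
      (b := fun x y => (g x).1 y * (h y).1 t) fun x => tendsto_mul_right_zero (g x).2 _)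
  have h1 : ∀ y, Summable fun x => a.1 x * (g x).1 y := fun y =>
    summable_of_zeroConvergent (tendsto_mul_right_zero a.2 _)
  have h2 : ∀ x, Summable fun y => (g x).1 y * (h y).1 t := fun x =>
    summable_of_zeroConvergent (tendsto_mul_right_zero (g x).2 _)
  calc ∑' y, (∑' x, a.1 x * (g x).1 y) * (h y).1 t
      = ∑' y, ∑' x, a.1 x * ((g x).1 y * (h y).1 t) :=
        tsum_congr fun y => by
          rw [← (h1 y).tsum_mul_right]
          exact tsum_congr fun x => mul_assoc _ _ _
    _ = ∑' x, ∑' y, a.1 x * ((g x).1 y * (h y).1 t) := hs.tsum_comm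
    _ = ∑' x, a.1 x * ∑' y, (g x).1 y * (h y).1 t :=
        tsum_congr fun x => (h2 x).tsum_mul_left _

theorem add_bind (a b : FormalSum R X) (g : X → FormalSum R Y) :
    bind (a + b) g = bind a g + bind b g := by
  ext y
  change ∑' x, (a.1 x + b.1 x) * (g x).1 y
    = ∑' x, a.1 x * (g x).1 y + ∑' x, b.1 x * (g x).1 y
  rw [← Summable.tsum_add
    (summable_of_zeroConvergent (tendsto_mul_right_zero a.2 fun x => (g x).1 y))
    (summable_of_zeroConvergent (tendsto_mul_right_zero b.2 fun x => (g x).1 y))]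
  exact tsum_congr fun x => add_mul _ _ _

theorem smul_bind (r : R) (a : FormalSum R X) (g : X → FormalSum R Y) :
    bind (r • a) g = r • bind a g := by
  ext y
  change ∑' x, (r * a.1 x) * (g x).1 y = r * ∑' x, a.1 x * (g x).1 y
  rw [← (summable_of_zeroConvergent
    (tendsto_mul_right_zero a.2 fun x => (g x).1 y)).tsum_mul_left]
  exact tsum_congr fun x => mul_assoc _ _ _

end FormalSum

end FormalSums

/-! ### The monad `R[[-]]` and contramodules -/

section Contramodules

variable (R : Type u) [Ring R] [UniformSpace R] [IsUniformAddGroup R] [IsTopologicalRing R]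
  [IsLinearTopology Rᵐᵒᵖ R] [T2Space R] [CompleteSpace R]

/-- The monad `X ↦ R[[X]]` on the category of sets. -/
noncomputable def formalSumMonad : Monad (Type u) where
  obj X := FormalSum R X
  map f := ↾(FormalSum.map f)
  map_id X := by
    refine ConcreteCategory.hom_ext _ _ fun a => ?_
    change FormalSum.map id a = a
    rw [FormalSum.map_eq]
    exact FormalSum.bind_single a
  map_comp f g := by
    refine ConcreteCategory.hom_ext _ _ fun a => ?_
    change FormalSum.map (fun x => g (f x)) a = FormalSum.map g (FormalSum.map f a)
    simp only [FormalSum.map_eq, FormalSum.bind_bind, FormalSum.single_bind]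
  η := ⟨fun X => ↾(FormalSum.single), fun X Y f => by
    refine ConcreteCategory.hom_ext _ _ fun x => ?_
    change FormalSum.single (f x) = FormalSum.map f (FormalSum.single x)
    simp only [FormalSum.map_eq, FormalSum.single_bind]⟩
  μ := ⟨fun X => ↾(FormalSum.join), fun X Y f => by
    refine ConcreteCategory.hom_ext _ _ fun z => ?_
    change FormalSum.join (FormalSum.map (FormalSum.map f) z)
      = FormalSum.map f (FormalSum.join z)
    simp only [FormalSum.join_eq, FormalSum.map_eq, FormalSum.bind_bind, FormalSum.single_bind,
      id]⟩
  assoc X := by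
    refine ConcreteCategory.hom_ext _ _ fun z => ?_
    change FormalSum.join (FormalSum.map FormalSum.join z)
      = FormalSum.join (FormalSum.join z)
    simp only [FormalSum.join_eq, FormalSum.map_eq, FormalSum.bind_bind, FormalSum.single_bind,
      id]
  left_unit X := by
    refine ConcreteCategory.hom_ext _ _ fun a => ?_
    change FormalSum.join (FormalSum.single a) = a
    rw [FormalSum.join_eq, FormalSum.single_bind, id]
  right_unit X := by
    refine ConcreteCategory.hom_ext _ _ fun a => ?_
    change FormalSum.join (FormalSum.map FormalSum.single a) = a
    simp only [FormalSum.join_eq, FormalSum.map_eq, FormalSum.bind_bind, FormalSum.single_bind,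
      id]
    exact FormalSum.bind_single a

/-- Left `R`-contramodules: the modules (algebras) over the monad `R[[-]]`. -/
abbrev Contra : Type (u + 1) := (formalSumMonad R).Algebra

variable {R}

namespace Contra

/-- The contraaction map `R[[P]] → P`. -/
def act (P : Contra R) (a : FormalSum R P.A) : P.A := P.a a

theorem act_single (P : Contra R) (p : P.A) : P.act (FormalSum.single p) = p :=
  ConcreteCategory.congr_hom P.unit p

theorem act_join (P : Contra R) (z : FormalSum R (FormalSum R P.A)) :
    P.act (FormalSum.join z) = P.act (FormalSum.map P.act z) :=
  ConcreteCategory.congr_hom P.assoc z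

theorem hom_act {P Q : Contra R} (g : P ⟶ Q) (a : FormalSum R P.A) :
    g.f (P.act a) = Q.act (FormalSum.map g.f a) :=
  (ConcreteCategory.congr_hom g.h a).symm

theorem act_surjective (P : Contra R) : Function.Surjective P.act :=
  fun p => ⟨_, P.act_single p⟩

noncomputable instance (P : Contra R) : Zero P.A := ⟨P.act 0⟩

noncomputable instance (P : Contra R) : Add P.A :=
  ⟨fun p q => P.act (FormalSum.single p + FormalSum.single q)⟩

noncomputable instance (P : Contra R) : SMul R P.A :=
  ⟨fun r p => P.act (r • FormalSum.single p)⟩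

noncomputable instance (P : Contra R) : Neg P.A :=
  ⟨fun p => (-1 : R) • p⟩

theorem zero_def (P : Contra R) : (0 : P.A) = P.act 0 := rfl

theorem add_def (P : Contra R) (p q : P.A) :
    p + q = P.act (FormalSum.single p + FormalSum.single q) := rfl

theorem smul_def (P : Contra R) (r : R) (p : P.A) : r • p = P.act (r • FormalSum.single p) := rfl

theorem act_add (P : Contra R) (a b : FormalSum R P.A) : P.act (a + b) = P.act a + P.act b := by
  have h := P.act_join (FormalSum.single a + FormalSum.single b)
  simp only [FormalSum.join_eq, FormalSum.map_eq, FormalSum.add_bind, FormalSum.single_bind,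
    id] at h
  exact h

theorem act_smul (P : Contra R) (r : R) (a : FormalSum R P.A) : P.act (r • a) = r • P.act a := by
  have h := P.act_join (r • FormalSum.single a)
  simp only [FormalSum.join_eq, FormalSum.map_eq, FormalSum.smul_bind, FormalSum.single_bind,
    id] at h
  exact h

theorem act_neg (P : Contra R) (a : FormalSum R P.A) : P.act (-a) = -P.act a := by
  rw [← neg_one_smul R a, act_smul]
  rfl

/-- The additive group structure on a contramodule: `p + q` is the contraaction applied to the
finite formal linear combination `1 · p + 1 · q`. -/
noncomputable instance (P : Contra R) : AddCommGroup P.A where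
  add_assoc p q r := by
    obtain ⟨a, rfl⟩ := P.act_surjective p
    obtain ⟨b, rfl⟩ := P.act_surjective q
    obtain ⟨c, rfl⟩ := P.act_surjective r
    simp only [← act_add, add_assoc]
  zero_add p := by
    obtain ⟨a, rfl⟩ := P.act_surjective p
    rw [zero_def, ← act_add, zero_add]
  add_zero p := by
    obtain ⟨a, rfl⟩ := P.act_surjective p
    rw [zero_def, ← act_add, add_zero]
  add_comm p q := by
    obtain ⟨a, rfl⟩ := P.act_surjective p
    obtain ⟨b, rfl⟩ := P.act_surjective q
    rw [← act_add, ← act_add, add_comm]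
  neg_add_cancel p := by
    obtain ⟨a, rfl⟩ := P.act_surjective p
    rw [← act_neg, ← act_add, neg_add_cancel, zero_def]
  nsmul := nsmulRec
  zsmul := zsmulRec

/-- The underlying left `R`-module of a contramodule: `r • p` is the contraaction applied to
the finite formal linear combination `r · p`. -/
noncomputable instance (P : Contra R) : Module R P.A where
  one_smul p := by
    obtain ⟨a, rfl⟩ := P.act_surjective p
    rw [← act_smul, one_smul]
  mul_smul r s p := by
    obtain ⟨a, rfl⟩ := P.act_surjective p
    simp only [← act_smul, mul_smul]
  smul_zero r := by rw [zero_def, ← act_smul, smul_zero]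
  smul_add r p q := by
    obtain ⟨a, rfl⟩ := P.act_surjective p
    obtain ⟨b, rfl⟩ := P.act_surjective q
    simp only [← act_smul, ← act_add, smul_add]
  add_smul r s p := by
    obtain ⟨a, rfl⟩ := P.act_surjective p
    simp only [← act_smul, ← act_add, add_smul]
  zero_smul p := by
    obtain ⟨a, rfl⟩ := P.act_surjective p
    rw [← act_smul, zero_smul, zero_def]

theorem hom_add {P Q : Contra R} (g : P ⟶ Q) (p q : P.A) : g.f (p + q) = g.f p + g.f q := by
  simp only [add_def, hom_act, FormalSum.map_eq, FormalSum.add_bind, FormalSum.single_bind]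

theorem hom_smul {P Q : Contra R} (g : P ⟶ Q) (r : R) (p : P.A) :
    g.f (r • p) = r • g.f p := by
  simp only [smul_def, hom_act, FormalSum.map_eq, FormalSum.smul_bind, FormalSum.single_bind]

variable (R) in
/-- The forgetful functor from left `R`-contramodules to left `R`-modules. -/
noncomputable def forgetToModule : Contra R ⥤ ModuleCat.{u} R where
  obj P := ModuleCat.of R P.A
  map g := ModuleCat.ofHom
    { toFun := g.f
      map_add' := hom_add g
      map_smul' := hom_smul g }
  map_id _ := rfl
  map_comp _ _ := rfl

/-- For an additive subgroup `A` of `R` (closed, in the intended use), the subgroup `A ⋌ P` of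
`P`: the image under the contraaction map of the formal linear combinations with all
coefficients in `A`. -/
noncomputable def contraSMul (A : AddSubgroup R) (P : Contra R) : AddSubgroup P.A where
  carrier := P.act '' {a | ∀ p, a.1 p ∈ A}
  add_mem' := by
    rintro _ _ ⟨a, ha, rfl⟩ ⟨b, hb, rfl⟩
    exact ⟨a + b, fun p => A.add_mem (ha p) (hb p), P.act_add a b⟩
  zero_mem' := ⟨0, fun _ => A.zero_mem, rfl⟩
  neg_mem' := by
    rintro _ ⟨a, ha, rfl⟩
    exact ⟨-a, fun p => A.neg_mem (ha p), P.act_neg a⟩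

variable (R) in
/-- A contramodule `P` is separated if the intersection of the subgroups `I ⋌ P` over all open
right ideals `I` of `R`, that is, the kernel of `P → lim P / (I ⋌ P)`, is zero. -/
def isSeparated : ObjectProperty (Contra R) := fun P =>
  ∀ p : P.A, (∀ I : Submodule Rᵐᵒᵖ R, IsOpen (I : Set R) → p ∈ contraSMul I.toAddSubgroup P) →
    p = 0

end Contra

variable (R) in
/-- The full subcategory of separated left `R`-contramodules. -/
abbrev Separ : Type (u + 1) := (Contra.isSeparated R).FullSubcategory

variable (R) in
/-- The forgetful functor from separated left `R`-contramodules to left `R`-modules. -/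
noncomputable abbrev Separ.forgetToModule : Separ R ⥤ ModuleCat.{u} R :=
  (Contra.isSeparated R).ι ⋙ Contra.forgetToModule R

end Contramodules

/-! ### Restriction of scalars -/

section Restriction

variable {R S : Type u}
  [Ring R] [UniformSpace R] [IsUniformAddGroup R] [IsTopologicalRing R]
  [IsLinearTopology Rᵐᵒᵖ R] [T2Space R] [CompleteSpace R]
  [Ring S] [UniformSpace S] [IsUniformAddGroup S] [IsTopologicalRing S]
  [IsLinearTopology Sᵐᵒᵖ S] [T2Space S] [CompleteSpace S]
  (f : R →+* S) (hf : Continuous f)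

namespace FormalSum

/-- The map `R[[X]] → S[[X]]` applying `f` to all coefficients. -/
def mapCoeff {X : Type v} (a : FormalSum R X) : FormalSum S X :=
  ⟨fun x => f (a.1 x), by
    have h := (hf.tendsto 0).comp a.2
    rw [map_zero] at h
    exact h⟩

theorem mapCoeff_single {X : Type v} (x : X) :
    mapCoeff f hf (single x) = single x := by
  classical
  ext y
  change f ((Pi.single x (1 : R) : X → R) y) = (Pi.single x (1 : S) : X → S) y
  by_cases h : y = x
  · subst h
    rw [Pi.single_eq_same, Pi.single_eq_same, map_one]
  · rw [Pi.single_eq_of_ne h, Pi.single_eq_of_ne h, map_zero]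

theorem mapCoeff_bind {X : Type v} {Y : Type w} (a : FormalSum R X) (g : X → FormalSum R Y) :
    mapCoeff f hf (bind a g) = bind (mapCoeff f hf a) fun x => mapCoeff f hf (g x) := by
  ext y
  change f (∑' x, a.1 x * (g x).1 y) = ∑' x, f (a.1 x) * f ((g x).1 y)
  rw [(summable_of_zeroConvergent (tendsto_mul_right_zero a.2 _)).map_tsum f hf]
  exact tsum_congr fun x => map_mul f _ _

theorem mapCoeff_map {X : Type v} {Y : Type w} (g : X → Y) (a : FormalSum R X) :
    mapCoeff f hf (map g a) = map g (mapCoeff f hf a) := by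
  simp only [map_eq, mapCoeff_bind, mapCoeff_single]

theorem mapCoeff_join {X : Type v} (z : FormalSum R (FormalSum R X)) :
    mapCoeff f hf (join z) = join (mapCoeff f hf (map (mapCoeff f hf) z)) := by
  simp only [join_eq, map_eq, mapCoeff_bind, mapCoeff_single, bind_bind, single_bind, id]

theorem mapCoeff_add {X : Type v} (a b : FormalSum R X) :
    mapCoeff f hf (a + b) = mapCoeff f hf a + mapCoeff f hf b := by
  ext x
  exact map_add f _ _

theorem mapCoeff_smul {X : Type v} (r : R) (a : FormalSum R X) :
    mapCoeff f hf (r • a) = f r • mapCoeff f hf a := by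
  ext x
  exact map_mul f _ _

theorem mapCoeff_zero {X : Type v} : mapCoeff f hf (0 : FormalSum R X) = 0 := by
  ext x
  exact map_zero f

end FormalSum

/-- The morphism of monads `R[[-]] → S[[-]]` induced by a continuous ring homomorphism. -/
noncomputable def formalSumMonadHom : formalSumMonad R ⟶ formalSumMonad S where
  app X := ↾(FormalSum.mapCoeff f hf)
  naturality X Y g := ConcreteCategory.hom_ext _ _ fun a => FormalSum.mapCoeff_map f hf g a
  app_η X := ConcreteCategory.hom_ext _ _ fun x => FormalSum.mapCoeff_single f hf x
  app_μ X := by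
    refine ConcreteCategory.hom_ext _ _ fun z => ?_
    exact FormalSum.mapCoeff_join f hf z

/-- Restriction of scalars for contramodules along a continuous ring homomorphism. -/
noncomputable def Contra.restrictScalars : Contra S ⥤ Contra R :=
  Monad.algebraFunctorOfMonadHom (formalSumMonadHom f hf)

/-- The contraaction map of the underlying `R`-contramodule of an `S`-contramodule. -/
theorem Contra.restrictScalars_act (P : Contra S) (a : FormalSum R P.A) :
    ((Contra.restrictScalars f hf).obj P).act a = P.act (FormalSum.mapCoeff f hf a) := rfl

theorem Contra.restrictScalars_zero (P : Contra S) :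
    (0 : ((Contra.restrictScalars f hf).obj P).A) = (0 : P.A) := by
  rw [Contra.zero_def, Contra.zero_def]
  exact congrArg P.act (FormalSum.mapCoeff_zero f hf)

theorem Contra.restrictScalars_add (P : Contra S) (p q : P.A) :
    ((Contra.restrictScalars f hf).obj P).act
      ((FormalSum.single p + FormalSum.single q : FormalSum R P.A)) = p + q := by
  change P.act (FormalSum.mapCoeff f hf (FormalSum.single p + FormalSum.single q)) = _
  rw [FormalSum.mapCoeff_add, FormalSum.mapCoeff_single, FormalSum.mapCoeff_single]
  rfl

theorem Contra.restrictScalars_smul (P : Contra S) (r : R) (p : P.A) :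
    ((Contra.restrictScalars f hf).obj P).act
      (r • FormalSum.single p : FormalSum R P.A) = f r • p := by
  change P.act (FormalSum.mapCoeff f hf (r • FormalSum.single p)) = _
  rw [FormalSum.mapCoeff_smul, FormalSum.mapCoeff_single]
  rfl

theorem Contra.isSeparated_restrictScalars (P : Contra S) (hP : Contra.isSeparated S P) :
    Contra.isSeparated R ((Contra.restrictScalars f hf).obj P) := by
  intro p hp
  rw [Contra.restrictScalars_zero]
  refine hP p fun J hJ => ?_
  let I : Submodule Rᵐᵒᵖ R :=
    { carrier := f ⁻¹' J
      add_mem' := fun {a b} ha hb => by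
        change f (a + b) ∈ J
        rw [map_add]
        exact J.add_mem ha hb
      zero_mem' := by
        change f 0 ∈ J
        rw [map_zero]
        exact J.zero_mem
      smul_mem' := fun r a ha => by
        change f (a * r.unop) ∈ J
        rw [map_mul]
        exact J.smul_mem (MulOpposite.op (f r.unop)) ha }
  obtain ⟨a, ha, hap⟩ := hp I (hJ.preimage hf)
  exact ⟨FormalSum.mapCoeff f hf a, fun q => ha q, hap⟩

/-- Restriction of scalars for separated contramodules. -/
noncomputable def Separ.restrictScalars : Separ S ⥤ Separ R :=
  (Contra.isSeparated R).lift ((Contra.isSeparated S).ι ⋙ Contra.restrictScalars f hf)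
    fun P => Contra.isSeparated_restrictScalars f hf P.obj P.property

/-- A bijection that respects the operations, as an isomorphism of modules. -/
def moduleIsoOfEquiv (M N : ModuleCat.{u} R) (e : M ≃ N) (hadd : ∀ x y, e (x + y) = e x + e y)
    (hsmul : ∀ (r : R) x, e (r • x) = r • e x) : M ≅ N :=
  LinearEquiv.toModuleIso { e with map_add' := hadd, map_smul' := hsmul }

/-- The commutative square formed by the forgetful functors `Separ S ⥤ ModuleCat S` and
`Separ R ⥤ ModuleCat R` and the restrictions of scalars, commuting up to the natural isomorphism
which is the identity map on underlying sets. -/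
noncomputable def Separ.squareIso :
    Separ.forgetToModule S ⋙ ModuleCat.restrictScalars.{u} f ≅
      Separ.restrictScalars f hf ⋙ Separ.forgetToModule R :=
  NatIso.ofComponents (fun P => moduleIsoOfEquiv
      ((ModuleCat.restrictScalars.{u} f).obj ((Separ.forgetToModule S).obj P))
      ((Separ.forgetToModule R).obj ((Separ.restrictScalars f hf).obj P))
      (Equiv.refl P.obj.A)
      (fun p q => (Contra.restrictScalars_add f hf P.obj p q).symm)
      (fun r p => (Contra.restrictScalars_smul f hf P.obj r p).symm))
    fun _ => rfl

/-- A ring map `f : R → S` is strongly right taut if the open two-sided ideals `I` of `R` for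
which the closure of the right ideal `f(I) S` is an open two-sided ideal of `S` form a base of
neighbourhoods of zero in `R`. -/
def IsStronglyRightTaut : Prop :=
  (𝓝 (0 : R)).HasBasis
    (fun I : TwoSidedIdeal R => IsOpen (I : Set R) ∧
      ∃ J : TwoSidedIdeal S, IsOpen (J : Set S) ∧
        (J : Set S) = closure (Submodule.span Sᵐᵒᵖ (f '' (I : Set R)) : Set S))
    (fun I => (I : Set R))

end Restriction

/-! ### Pseudopullback squares -/

section Pseudopullback

open Limits CategoricalPullback

/-- A square of functors commuting up to a given natural isomorphism is a pseudopullback diagram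
if the comparison functor to the category of triples `(a, b, F a ≅ G b)` is an equivalence. -/
def IsPseudopullback {A B C D : Type*} [Category A] [Category B] [Category C] [Category D]
    {T : D ⥤ A} {L : D ⥤ B} {F : A ⥤ C} {G : B ⥤ C} (e : T ⋙ F ≅ L ⋙ G) : Prop :=
  ((CatCommSqOver.toFunctorToCategoricalPullback F G D).obj ⟨T, L, e⟩).IsEquivalence

end Pseudopullback

/-! ### Further operations on formal linear combinations -/

section FormalSums

variable {R : Type u} [Ring R] [UniformSpace R] [IsUniformAddGroup R] [IsTopologicalRing R]
  [IsLinearTopology Rᵐᵒᵖ R]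
variable {X : Type v} {Y : Type w}

namespace FormalSum

/-! Infinite operations over `S` reduce to infinite operations over `R` combined with scalar
multiplications by elements of `S`. By `exists_spread_eq`, every element of `S[[X]]` has the form `∑
f(r) s x` for some zero-convergent family of coefficients `r` indexed by pairs `(s, x)`. If `J` is
the closure of `f(I) S` and the given element has coefficients in `J`, then the `r` can be chosen in
`I`. This is successive approximation along a sequence of such pairs `(I, J)`, with the corrections
summed in `R`.

Full faithfulness over `S` follows: an `S`-linear map is `R`-linear, so it commutes with the
contraaction of `R`, and hence with that of `S`. Passing to the full subcategories of separated
contramodules costs nothing.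

For essential surjectivity, let `P` be a separated `R`-contramodule with a compatible `S`-module
structure. The only possible contraaction sends `∑ f(r) s x` to `∑ r (s x)`, computed in `P`. It is
well defined because a formal combination that spreads to coefficients in `J` has value in `I ⋌ P`
(`spreadAct_mem_of_spread_mem`), while the intersection of the `I ⋌ P` is zero. Two consequences of
fullness over `R` enter. The map `s ↦ s x` respects `R`-contraactions, so `J x ⊆ I ⋌ P`. The
quotient of `P` by `R I P` is a contramodule whose projection is a morphism, so `I ⋌ P ⊆ R I P`;
this makes `I ⋌ P` stable under `S` and the new contraaction `S`-linear. -/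

theorem map_coeff_mem (I : Submodule Rᵐᵒᵖ R) (hI : IsOpen (I : Set R)) (g : X → Y)
    (a : FormalSum R X) (ha : ∀ x, a.1 x ∈ I) (y : Y) : (map g a).1 y ∈ I :=
  tsum_mem_of_isOpen I hI fun x => ha x

theorem zero_bind (g : X → FormalSum R Y) : bind 0 g = 0 := by
  ext y
  change ∑' x, (0 : R) * (g x).1 y = 0
  simp only [zero_mul, tsum_zero]

theorem sum_coeff {ι : Type*} (s : Finset ι) (a : ι → FormalSum R X) (x : X) :
    (∑ i ∈ s, a i).1 x = ∑ i ∈ s, (a i).1 x := by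
  rw [Submodule.coe_sum, Finset.sum_apply]

open Classical in
theorem smul_single_coeff (r : R) (x y : X) :
    (r • (single x : FormalSum R X)).1 y = if x = y then r else 0 := by
  change r * (Pi.single x (1 : R) : X → R) y = _
  by_cases h : x = y
  · subst h
    rw [Pi.single_eq_same, mul_one, if_pos rfl]
  · rw [Pi.single_eq_of_ne (Ne.symm h), mul_zero, if_neg h]

/-- A formal linear combination is congruent to a finite one modulo any open right ideal. -/
theorem exists_finset_sub_sum_mem (I : Submodule Rᵐᵒᵖ R) (hI : IsOpen (I : Set R))
    (a : FormalSum R X) :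
    ∃ s : Finset X, ∀ x, (a - ∑ y ∈ s, a.1 y • (single y : FormalSum R X)).1 x ∈ I := by
  classical
  have h1 : {x | a.1 x ∉ I}.Finite := Tendsto.eventually a.2 (hI.mem_nhds I.zero_mem)
  refine ⟨h1.toFinset, fun x => ?_⟩
  have h2 : (a - ∑ y ∈ h1.toFinset, a.1 y • (single y : FormalSum R X)).1 x
      = a.1 x - if x ∈ h1.toFinset then a.1 x else 0 := by
    change a.1 x - (∑ y ∈ h1.toFinset, a.1 y • (single y : FormalSum R X)).1 x = _
    rw [sum_coeff]
    simp only [smul_single_coeff, Finset.sum_ite_eq']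
  rw [h2]
  split_ifs with h
  · rw [sub_self]
    exact I.zero_mem
  · rw [sub_zero]
    by_contra hx
    exact h (h1.mem_toFinset.2 hx)

variable [T2Space R] [CompleteSpace R]

theorem map_map {Z : Type*} (g : X → Y) (h : Y → Z) (a : FormalSum R X) :
    map h (map g a) = map (fun x => h (g x)) a := by
  simp only [map_eq, bind_bind, single_bind]

theorem map_add (g : X → Y) (a b : FormalSum R X) : map g (a + b) = map g a + map g b := by
  simp only [map_eq, add_bind]

theorem map_smul (g : X → Y) (r : R) (a : FormalSum R X) : map g (r • a) = r • map g a := by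
  simp only [map_eq, smul_bind]

theorem map_single (g : X → Y) (x : X) :
    map g (single x) = (single (g x) : FormalSum R Y) := by
  simp only [map_eq, single_bind]

theorem map_bind {Z : Type*} (a : FormalSum R X) (g : X → FormalSum R Y) (h : Y → Z) :
    map h (bind a g) = bind a fun x => map h (g x) := by
  simp only [map_eq, bind_bind]

theorem bind_map {Z : Type*} (g : X → Y) (a : FormalSum R X) (h : Y → FormalSum R Z) :
    bind (map g a) h = bind a fun x => h (g x) := by
  simp only [map_eq, bind_bind, single_bind]

end FormalSum

end FormalSums

/-! ### Contraactions determined by the underlying operations -/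

section Contramodules

variable {R : Type u} [Ring R] [UniformSpace R] [IsUniformAddGroup R] [IsTopologicalRing R]
  [IsLinearTopology Rᵐᵒᵖ R] [T2Space R] [CompleteSpace R]

namespace Contra

theorem act_bind (P : Contra R) {X : Type u} (a : FormalSum R X) (g : X → FormalSum R P.A) :
    P.act (FormalSum.bind a g) = P.act (FormalSum.map (fun x => P.act (g x)) a) := by
  have h := P.act_join (FormalSum.map g a)
  rwa [FormalSum.join_eq, FormalSum.bind_map, FormalSum.map_map] at h

/-- A contramodule given by a contraaction map. -/
noncomputable def ofAct (A : Type u) (α : FormalSum R A → A)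
    (hunit : ∀ x, α (FormalSum.single x) = x)
    (hassoc : ∀ z, α (FormalSum.join z) = α (FormalSum.map α z)) : Contra R where
  A := A
  a := ↾α
  unit := ConcreteCategory.hom_ext _ _ hunit
  assoc := ConcreteCategory.hom_ext _ _ hassoc

/-- A map commuting with the contraactions is a morphism of contramodules. -/
def homMk {P Q : Contra R} (g : P.A → Q.A)
    (hg : ∀ a, g (P.act a) = Q.act (FormalSum.map g a)) : P ⟶ Q where
  f := ↾g
  h := ConcreteCategory.hom_ext _ _ fun a => (hg a).symm

/-- If the forgetful functor to modules is full, every linear map of contramodules commutes with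
the contraactions. -/
theorem map_act_of_full [(forgetToModule R).Full] {P Q : Contra R} (g : P.A → Q.A)
    (hadd : ∀ x y, g (x + y) = g x + g y) (hsmul : ∀ (r : R) x, g (r • x) = r • g x)
    (a : FormalSum R P.A) : g (P.act a) = Q.act (FormalSum.map g a) := by
  let G : (forgetToModule R).obj P ⟶ (forgetToModule R).obj Q :=
    ModuleCat.ofHom { toFun := g, map_add' := hadd, map_smul' := hsmul }
  obtain ⟨h, hh⟩ := (forgetToModule R).map_surjective G
  have hg : ∀ x, h.f x = g x := fun x => ConcreteCategory.congr_hom hh x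
  have hg' : (h.f : P.A → Q.A) = g := funext hg
  have := hom_act h a
  rwa [hg'] at this

theorem faithful_forgetToModule : (forgetToModule R).Faithful where
  map_injective {P Q} g h hgh := by
    refine Monad.Algebra.Hom.ext (ConcreteCategory.hom_ext _ _ fun x => ?_)
    exact ConcreteCategory.congr_hom hgh x

/-- A module annihilated by an open right ideal is a contramodule. -/
theorem exists_contra_of_smul_eq_zero (N : Type u) [AddCommGroup N] [Module R N]
    (I : Submodule Rᵐᵒᵖ R) (hI : IsOpen (I : Set R)) (hN : ∀ r ∈ I, ∀ x : N, r • x = 0) :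
    ∃ α : FormalSum R N → N, (∀ x, α (FormalSum.single x) = x) ∧
      (∀ z, α (FormalSum.join z) = α (FormalSum.map α z)) ∧
      (∀ a b, α (a + b) = α a + α b) ∧ (∀ (r : R) a, α (r • a) = r • α a) ∧
      (∀ a : FormalSum R N, (∀ x, a.1 x ∈ I) → α a = 0) := by
  -- With the discrete topology on `N`, the sums `∑ aₙ n` have finitely many nonzero terms, since
  -- `I` kills `N` and almost all coefficients lie in `I`; results on infinite sums then allow
  -- exchanging them.
  let _ : UniformSpace N := ⊥
  have : DiscreteTopology N := ⟨rfl⟩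
  have hfin : ∀ {X : Type u} (a : X → R), Tendsto a cofinite (𝓝 0) → ∀ h : X → N,
      Summable fun x => a x • h x := fun {X} a ha h => by
    refine summable_of_hasFiniteSupport
      ((show {x | a x ∉ I}.Finite from Tendsto.eventually ha (hI.mem_nhds I.zero_mem)).subset ?_)
    intro x hx hxI
    exact hx (hN _ hxI _)
  -- The orbit map vanishes on the open ideal `I`. Continuity lets it pass through the infinite sums
  -- in `R` that define the coefficients of a `bind`.
  have hcont : ∀ x : N, Continuous fun r : R => r • x := fun x => by
    refine continuous_of_continuousAt_zero (LinearMap.toSpanSingleton R N x) ?_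
    refine Tendsto.congr' ?_ tendsto_const_nhds
    filter_upwards [hI.mem_nhds I.zero_mem] with r hr
    exact (map_zero _).trans (hN r hr x).symm
  have hbind : ∀ {X : Type u} (a : FormalSum R X) (g : X → FormalSum R N),
      ∑' n, (FormalSum.bind a g).1 n • n = ∑' x, a.1 x • ∑' n, (g x).1 n • n := by
    intro X a g
    have h1 : ∀ n : N, Summable fun x => a.1 x * (g x).1 n := fun n =>
      summable_of_zeroConvergent (tendsto_mul_right_zero a.2 _)
    have h2 : Summable (Function.uncurry fun (x : X) (n : N) => (a.1 x * (g x).1 n) • n) :=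
      hfin _ (tendsto_mul_prod_zero a.2 fun x => (g x).2) fun p : X × N => p.2
    calc ∑' n, (∑' x, a.1 x * (g x).1 n) • n
        = ∑' n, ∑' x, (a.1 x * (g x).1 n) • n :=
          tsum_congr fun n => (h1 n).map_tsum (LinearMap.toSpanSingleton R N n) (hcont n)
      _ = ∑' x, ∑' n, (a.1 x * (g x).1 n) • n := h2.tsum_comm
      _ = ∑' x, a.1 x • ∑' n, (g x).1 n • n := tsum_congr fun x =>
          (tsum_congr fun n => mul_smul (a.1 x) ((g x).1 n) n).trans
            ((hfin _ (g x).2 id).map_tsum (DistribSMul.toAddMonoidHom N (a.1 x))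
              continuous_of_discreteTopology).symm
  have hunit : ∀ x : N, ∑' n, (FormalSum.single x : FormalSum R N).1 n • n = x := fun x => by
    classical
    change ∑' n, (Pi.single x (1 : R) : N → R) n • n = x
    rw [tsum_eq_single x fun y h => by rw [Pi.single_eq_of_ne h, zero_smul], Pi.single_eq_same,
      one_smul]
  refine ⟨fun a => ∑' n, a.1 n • n, hunit, fun z => ?_, fun a b => ?_, fun r a => ?_,
    fun a ha => ?_⟩
  · simp only [FormalSum.join_eq, FormalSum.map_eq, hbind, hunit, id]
  · exact (tsum_congr fun n => add_smul _ _ n).trans ((hfin _ a.2 id).tsum_add (hfin _ b.2 id))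
  · refine (tsum_congr fun n => mul_smul r (a.1 n) n).trans ?_
    exact ((hfin _ a.2 id).map_tsum (DistribSMul.toAddMonoidHom N r)
      continuous_of_discreteTopology).symm
  · simp only [hN _ (ha _), tsum_zero]

/-- If the forgetful functor to modules is full, `I ⋌ P` is contained in the submodule `R I P`
for any open right ideal `I`. -/
theorem contraSMul_le_span_of_full [(forgetToModule R).Full] (P : Contra R)
    (I : Submodule Rᵐᵒᵖ R) (hI : IsOpen (I : Set R)) (p : P.A)
    (hp : p ∈ contraSMul I.toAddSubgroup P) :
    p ∈ Submodule.span R {x : P.A | ∃ r ∈ I, ∃ q : P.A, r • q = x} := by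
  -- The quotient by `V` is killed by `I`, hence is a contramodule in which combinations with
  -- coefficients in `I` act by zero. Fullness turns the linear projection into a morphism, so it
  -- kills `I ⋌ P`.
  set V := Submodule.span R {x : P.A | ∃ r ∈ I, ∃ q : P.A, r • q = x}
  obtain ⟨α, hunit, hassoc, hadd, hsmul, hI0⟩ :=
    exists_contra_of_smul_eq_zero (P.A ⧸ V) I hI fun r hr x => by
      obtain ⟨q, rfl⟩ := V.mkQ_surjective x
      rw [← _root_.map_smul]
      exact (Submodule.Quotient.mk_eq_zero V).2 (Submodule.subset_span ⟨r, hr, q, rfl⟩)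
  let Q : Contra R := ofAct (P.A ⧸ V) α hunit hassoc
  let g : P.A → Q.A := fun x => V.mkQ x
  obtain ⟨a, ha, rfl⟩ := hp
  have h := map_act_of_full (Q := Q) g
    (fun x y => (map_add V.mkQ x y).trans
      ((hadd _ _).trans (congrArg₂ (· + ·) (hunit _) (hunit _))).symm)
    (fun r x => (_root_.map_smul V.mkQ r x).trans
      ((hsmul r _).trans (congrArg (r • ·) (hunit _))).symm) a
  refine (Submodule.Quotient.mk_eq_zero V).1 (h.trans ?_)
  exact hI0 _ (FormalSum.map_coeff_mem I hI g a ha)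

end Contra

end Contramodules
/-! ### Approximation of formal linear combinations along a strongly right taut map -/

section Taut

variable {R S : Type u}
  [Ring R] [UniformSpace R] [IsUniformAddGroup R] [IsTopologicalRing R]
  [IsLinearTopology Rᵐᵒᵖ R] [T2Space R] [CompleteSpace R]
  [Ring S] [UniformSpace S] [IsUniformAddGroup S] [IsTopologicalRing S]
  [IsLinearTopology Sᵐᵒᵖ S] [T2Space S] [CompleteSpace S]
  (f : R →+* S)

/-- An open right ideal `I` of `R` and an open two-sided ideal `J` of `S` such that `J` is the
closure of `f(I) S`. -/
structure IsTautPair (I : Submodule Rᵐᵒᵖ R) (J : Submodule Sᵐᵒᵖ S) : Prop where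
  isOpen_left : IsOpen (I : Set R)
  isOpen_right : IsOpen (J : Set S)
  mul_mem : ∀ (s : S), ∀ t ∈ J, s * t ∈ J
  eq_closure : (J : Set S) = closure (Submodule.span Sᵐᵒᵖ (f '' (I : Set R)) : Set S)

/-- Since `f 1 = 1`, the right ideal generated by the image is everything. This pair is what allows
lifting formal combinations with no condition on their coefficients. -/
theorem isTautPair_top : IsTautPair f ⊤ ⊤ where
  isOpen_left := isOpen_univ
  isOpen_right := isOpen_univ
  mul_mem _ _ _ := trivial
  eq_closure := by
    have h : Submodule.span Sᵐᵒᵖ (f '' ((⊤ : Submodule Rᵐᵒᵖ R) : Set R)) = ⊤ := by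
      refine eq_top_iff.2 fun s _ => ?_
      have h1 := Submodule.smul_mem (Submodule.span Sᵐᵒᵖ (f '' ((⊤ : Submodule Rᵐᵒᵖ R) : Set R)))
        (MulOpposite.op s) (Submodule.subset_span ⟨1, trivial, map_one f⟩)
      rwa [op_smul_eq_mul, one_mul] at h1
    rw [h]
    exact closure_univ.symm

variable {f}

theorem IsTautPair.map_mem {I : Submodule Rᵐᵒᵖ R} {J : Submodule Sᵐᵒᵖ S} (h : IsTautPair f I J)
    {r : R} (hr : r ∈ I) : f r ∈ J := by
  change f r ∈ (J : Set S)
  rw [h.eq_closure]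
  exact subset_closure (Submodule.subset_span ⟨r, hr, rfl⟩)

theorem IsTautPair.exists_span_sub_mem {I : Submodule Rᵐᵒᵖ R} {J : Submodule Sᵐᵒᵖ S}
    (h : IsTautPair f I J) {K : Submodule Sᵐᵒᵖ S} (hK : IsOpen (K : Set S)) {s : S}
    (hs : s ∈ J) : ∃ t ∈ Submodule.span Sᵐᵒᵖ (f '' (I : Set R)), s - t ∈ K := by
  have hs' : s ∈ (J : Set S) := hs
  rw [h.eq_closure] at hs'
  have hU : {t | s - t ∈ K} ∈ 𝓝 s := by
    refine (hK.preimage (continuous_const.sub continuous_id)).mem_nhds ?_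
    change s - s ∈ K
    rw [sub_self]
    exact K.zero_mem
  obtain ⟨t, ht, htI⟩ := mem_closure_iff_nhds.1 hs' _ hU
  exact ⟨t, htI, ht⟩

theorem IsStronglyRightTaut.exists_isTautPair (h : IsStronglyRightTaut f) {U : Set R}
    (hU : U ∈ 𝓝 (0 : R)) :
    ∃ I J, IsTautPair f I J ∧ (I : Set R) ⊆ U := by
  obtain ⟨I, ⟨hI, J, hJ, hJc⟩, hIU⟩ := h.mem_iff.1 hU
  let I' : Submodule Rᵐᵒᵖ R :=
    { carrier := I
      add_mem' := I.add_mem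
      zero_mem' := I.zero_mem
      smul_mem' := fun r a ha => I.mul_mem_right a r.unop ha }
  let J' : Submodule Sᵐᵒᵖ S :=
    { carrier := J
      add_mem' := J.add_mem
      zero_mem' := J.zero_mem
      smul_mem' := fun r a ha => J.mul_mem_right a r.unop ha }
  exact ⟨I', J', ⟨hI, hJ, fun s t ht => J.mul_mem_left s t ht, hJc⟩, hIU⟩

/-- An open right ideal is closed, so once it contains `f(I)` it contains the closure of `f(I) S`.
With `f` continuous, `J` therefore becomes small as soon as `I` does. -/
theorem IsTautPair.le_of_le_comap {I : Submodule Rᵐᵒᵖ R} {J : Submodule Sᵐᵒᵖ S}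
    (h : IsTautPair f I J) {K : Submodule Sᵐᵒᵖ S} (hK : IsOpen (K : Set S))
    (hIK : ∀ r ∈ I, f r ∈ K) : J ≤ K := by
  intro s hs
  have hs' : s ∈ (J : Set S) := hs
  rw [h.eq_closure] at hs'
  refine (K.toAddSubgroup.isClosed_of_isOpen hK).closure_subset_iff.2 ?_ hs'
  refine (Submodule.span_le (p := K)).2 ?_
  rintro _ ⟨r, hr, rfl⟩
  exact hIK r hr

/-- A decreasing sequence of taut pairs starting at a given one, with both members forming bases
of neighbourhoods of zero. -/
theorem IsStronglyRightTaut.exists_seq (h : IsStronglyRightTaut f) (hf : Continuous f)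
    (hR : (𝓝 (0 : R)).IsCountablyGenerated)
    {I : Submodule Rᵐᵒᵖ R} {J : Submodule Sᵐᵒᵖ S} (hIJ : IsTautPair f I J) :
    ∃ (A : ℕ → Submodule Rᵐᵒᵖ R) (B : ℕ → Submodule Sᵐᵒᵖ S), A 0 = I ∧ B 0 = J ∧
      (∀ n, IsTautPair f (A n) (B n)) ∧ Antitone A ∧ (∀ U ∈ 𝓝 (0 : R), ∃ n, (A n : Set R) ⊆ U) ∧
      (∀ U ∈ 𝓝 (0 : S), ∃ N, ∀ n, N ≤ n → (B n : Set S) ⊆ U) := by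
  obtain ⟨V, hV⟩ := (𝓝 (0 : R)).exists_antitone_basis
  let T := {p : Submodule Rᵐᵒᵖ R × Submodule Sᵐᵒᵖ S // IsTautPair f p.1 p.2}
  have hstep : ∀ (n : ℕ) (p : T), ∃ q : T, (q.1.1 : Set R) ⊆ p.1.1 ∩ V n := fun n p => by
    obtain ⟨I', J', hp, hI'⟩ := h.exists_isTautPair
      (inter_mem (p.2.isOpen_left.mem_nhds p.1.1.zero_mem) (hV.mem n))
    exact ⟨⟨(I', J'), hp⟩, hI'⟩
  choose q hq using hstep
  let P : ℕ → T := fun n => Nat.rec ⟨(I, J), hIJ⟩ (fun n p => q n p) n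
  have hP : ∀ n, P (n + 1) = q n (P n) := fun _ => rfl
  have hA : Antitone fun n => (P n).1.1 := antitone_nat_of_succ_le fun n => by
    rw [hP]
    exact fun x hx => (hq n (P n) hx).1
  have hAU : ∀ U ∈ 𝓝 (0 : R), ∃ n, ((P n).1.1 : Set R) ⊆ U := fun U hU => by
    obtain ⟨n, -, hn⟩ := hV.toHasBasis.mem_iff.1 hU
    refine ⟨n + 1, ?_⟩
    rw [hP]
    exact fun x hx => hn (hq n (P n) hx).2
  refine ⟨fun n => (P n).1.1, fun n => (P n).1.2, rfl, rfl, fun n => (P n).2, hA, hAU,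
    fun U hU => ?_⟩
  obtain ⟨K, hK, hKU⟩ := (IsLinearTopology.hasBasis_open_submodule Sᵐᵒᵖ).mem_iff.1 hU
  obtain ⟨N, hN⟩ := hAU _ ((hK.preimage hf).mem_nhds (by
    change f 0 ∈ K
    rw [map_zero]
    exact K.zero_mem))
  exact ⟨N, fun n hn x hx => hKU ((P n).2.le_of_le_comap hK (fun r hr => hN (hA hn hr)) hx)⟩

variable (f) (hf : Continuous f)

/-! ### Lifting elements of `S[[X]]` to `R[[S × X]]` -/

namespace FormalSum

/-- The map `R[[S × X]] → S[[X]]` taking `∑ r (s, x)` to `∑ f(r) s x`. -/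
noncomputable def spread {X : Type v} (z : FormalSum R (S × X)) : FormalSum S X :=
  bind (mapCoeff f hf z) fun p => p.1 • single p.2

variable {X : Type v}

theorem spread_add (z w : FormalSum R (S × X)) :
    spread f hf (z + w) = spread f hf z + spread f hf w := by
  rw [spread, mapCoeff_add, add_bind]
  rfl

theorem spread_zero : spread f hf (0 : FormalSum R (S × X)) = 0 := by
  rw [spread, mapCoeff_zero, zero_bind]

theorem spread_sub (z w : FormalSum R (S × X)) :
    spread f hf (z - w) = spread f hf z - spread f hf w := by
  rw [eq_sub_iff_add_eq, ← spread_add, sub_add_cancel]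

theorem spread_sum {ι : Type*} (s : Finset ι) (z : ι → FormalSum R (S × X)) :
    spread f hf (∑ i ∈ s, z i) = ∑ i ∈ s, spread f hf (z i) := by
  classical
  induction s using Finset.induction_on with
  | empty => simp only [Finset.sum_empty, spread_zero]
  | insert i s hi ih => rw [Finset.sum_insert hi, Finset.sum_insert hi, spread_add, ih]

theorem spread_smul_single (r : R) (p : S × X) :
    spread f hf (r • single p) = (f r * p.1) • (single p.2 : FormalSum S X) := by
  rw [spread, mapCoeff_smul, mapCoeff_single, smul_bind, single_bind, mul_smul]

theorem spread_single (p : S × X) :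
    spread f hf (single p) = p.1 • (single p.2 : FormalSum S X) := by
  rw [spread, mapCoeff_single, single_bind]

theorem spread_map {Y : Type w} (g : X → Y) (z : FormalSum R (S × X)) :
    map g (spread f hf z) = spread f hf (map (fun p => (p.1, g p.2)) z) := by
  simp only [spread, mapCoeff_map, bind_map, map_bind, map_smul, map_single]

theorem spread_bind {Y : Type w} (z : FormalSum R X) (g : X → FormalSum R (S × Y)) :
    spread f hf (bind z g) = bind (mapCoeff f hf z) fun x => spread f hf (g x) := by
  simp only [spread, mapCoeff_bind, bind_bind]

theorem spread_coeff_mem {I : Submodule Rᵐᵒᵖ R} {J : Submodule Sᵐᵒᵖ S} (h : IsTautPair f I J)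
    (z : FormalSum R (S × X)) (hz : ∀ p, z.1 p ∈ I) (x : X) : (spread f hf z).1 x ∈ J :=
  tsum_mem_of_isOpen J h.isOpen_right fun p =>
    J.smul_mem (MulOpposite.op _) (h.map_mem (hz p))

theorem exists_spread_eq_smul_single (I : Submodule Rᵐᵒᵖ R) {t : S}
    (ht : t ∈ Submodule.span Sᵐᵒᵖ (f '' (I : Set R))) (x : X) :
    ∃ z : FormalSum R (S × X), (∀ p, z.1 p ∈ I) ∧ spread f hf z = t • single x := by
  classical
  induction ht using Submodule.closure_induction with
  | zero => exact ⟨0, fun _ => I.zero_mem, by rw [spread_zero, zero_smul]⟩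
  | add s t _ _ hs ht =>
    obtain ⟨z, hz, hzs⟩ := hs
    obtain ⟨w, hw, hwt⟩ := ht
    exact ⟨z + w, fun p => I.add_mem (hz p) (hw p), by rw [spread_add, hzs, hwt, add_smul]⟩
  | smul_mem s t ht =>
    obtain ⟨r, hr, rfl⟩ := ht
    refine ⟨r • single (s.unop, x), fun p => ?_, spread_smul_single f hf r (s.unop, x)⟩
    rw [smul_single_coeff]
    split_ifs
    exacts [hr, I.zero_mem]

/-- One step of the approximation: modulo `K` only finitely many coefficients matter, and each of
them is approximated by a finite sum of terms `f(r) s` with `r` in `I`. -/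
theorem exists_spread_sub_mem {I : Submodule Rᵐᵒᵖ R} {J : Submodule Sᵐᵒᵖ S}
    (h : IsTautPair f I J) {K : Submodule Sᵐᵒᵖ S} (hK : IsOpen (K : Set S))
    (a : FormalSum S X) (ha : ∀ x, a.1 x ∈ J) :
    ∃ z : FormalSum R (S × X), (∀ p, z.1 p ∈ I) ∧ ∀ x, (a - spread f hf z).1 x ∈ K := by
  classical
  obtain ⟨s, hs⟩ := exists_finset_sub_sum_mem K hK a
  choose t ht htK using fun x => h.exists_span_sub_mem hK (ha x)
  choose z hz hzt using fun x => exists_spread_eq_smul_single f hf I (ht x) x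
  refine ⟨∑ x ∈ s, z x, fun p => ?_, fun x => ?_⟩
  · rw [sum_coeff]
    exact I.sum_mem fun x _ => hz x p
  -- The error is the discarded tail plus the finitely many coefficient errors.
  · have h1 : a - spread f hf (∑ x ∈ s, z x) = (a - ∑ y ∈ s, a.1 y • (single y : FormalSum S X))
        + ∑ y ∈ s, (a.1 y - t y) • (single y : FormalSum S X) := by
      have h2 : ∑ y ∈ s, (a.1 y - t y) • (single y : FormalSum S X)
          = ∑ y ∈ s, a.1 y • (single y : FormalSum S X) - ∑ y ∈ s, t y • single y := by
        rw [← Finset.sum_sub_distrib]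
        exact Finset.sum_congr rfl fun y _ => sub_smul (a.1 y) (t y) (single y : FormalSum S X)
      have h3 : spread f hf (∑ x ∈ s, z x) = ∑ y ∈ s, t y • (single y : FormalSum S X) := by
        rw [spread_sum]
        exact Finset.sum_congr rfl fun y _ => hzt y
      rw [h2, h3, sub_add_sub_cancel]
    rw [h1]
    refine K.add_mem (hs x) ?_
    change (∑ y ∈ s, (a.1 y - t y) • (single y : FormalSum S X)).1 x ∈ K
    rw [sum_coeff]
    refine K.sum_mem fun y _ => ?_
    rw [smul_single_coeff]
    split_ifs
    exacts [htK y, K.zero_mem]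

/-- If `J` is the closure of `f(I) S`, every formal linear combination with coefficients in `J`
is obtained from one with coefficients in `I`. -/
theorem exists_spread_eq (htaut : IsStronglyRightTaut f)
    (hR : (𝓝 (0 : R)).IsCountablyGenerated) {I : Submodule Rᵐᵒᵖ R} {J : Submodule Sᵐᵒᵖ S}
    (h : IsTautPair f I J) (a : FormalSum S X) (ha : ∀ x, a.1 x ∈ J) :
    ∃ z : FormalSum R (S × X), (∀ p, z.1 p ∈ I) ∧ spread f hf z = a := by
  classical
  obtain ⟨A, B, hA0, hB0, hAB, hAanti, hAU, hBU⟩ := htaut.exists_seq hf hR h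
  choose ζ hζ hζB using fun (n : ℕ) (b : {b : FormalSum S X // ∀ x, b.1 x ∈ B n}) =>
    exists_spread_sub_mem f hf (hAB n) (hAB (n + 1)).isOpen_right b.1 b.2
  -- The successive remainders: the `n`-th has coefficients in `B n`, and its approximation modulo
  -- `B (n + 1)` is subtracted to give the next.
  let a' : ∀ n : ℕ, {b : FormalSum S X // ∀ x, b.1 x ∈ B n} := fun n =>
    Nat.rec ⟨a, by rw [hB0]; exact ha⟩ (fun n b => ⟨_, hζB n b⟩) n
  have ha' : ∀ n, (a' (n + 1)).1 = (a' n).1 - spread f hf (ζ n (a' n)) := fun _ => rfl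
  -- All corrections together, before summation over `n`. The family converges to zero because the
  -- `n`-th correction has coefficients in `A n`, which lies in `U` for large `n`; each earlier
  -- correction has finitely many coefficients outside `U`.
  let Z : FormalSum R (ℕ × (S × X)) := ⟨fun p => (ζ p.1 (a' p.1)).1 p.2, by
    refine (IsLinearTopology.hasBasis_open_submodule Rᵐᵒᵖ).tendsto_right_iff.2 fun U hU => ?_
    obtain ⟨N, hN⟩ := hAU _ (hU.mem_nhds U.zero_mem)
    have h1 : ∀ n, {p | (ζ n (a' n)).1 p ∉ U}.Finite := fun n =>
      Tendsto.eventually (ζ n (a' n)).2 (hU.mem_nhds U.zero_mem)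
    refine (((Finset.range N).finite_toSet).biUnion fun n _ =>
      (h1 n).image fun p => (n, p)).subset ?_
    rintro ⟨n, p⟩ hnp
    simp only [Set.mem_iUnion, Set.mem_image]
    refine ⟨n, ?_, p, hnp, rfl⟩
    refine Finset.mem_coe.2 (Finset.mem_range.2 ?_)
    by_contra hn
    exact hnp (hN (hAanti (not_lt.1 hn) (hζ n (a' n) p)))⟩
  refine ⟨map Prod.snd Z, map_coeff_mem I h.isOpen_left _ _ fun p => ?_, ?_⟩
  · rw [← hA0]
    exact hAanti (Nat.zero_le p.1) (hζ p.1 (a' p.1) p.2)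
  ext x
  have h1 : spread f hf (map Prod.snd Z)
      = bind (mapCoeff f hf Z) fun p => p.2.1 • (single p.2.2 : FormalSum S X) := by
    rw [spread, mapCoeff_map, bind_map]
  have h2 : Summable fun p : ℕ × (S × X) =>
      (mapCoeff f hf Z).1 p * (p.2.1 • (single p.2.2 : FormalSum S X)).1 x :=
    summable_of_zeroConvergent (tendsto_mul_right_zero (mapCoeff f hf Z).2 _)
  have : NonarchimedeanAddGroup S := nonarchimedean_of_rightLinear
  have h3 := h2.prod.hasSum
  have h4 : ∀ n, (spread f hf (ζ n (a' n))).1 x = (a' n).1.1 x - (a' (n + 1)).1.1 x := fun n => by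
    rw [ha']
    exact (sub_sub_cancel _ _).symm
  have h5 : Tendsto (fun n => (a' n).1.1 x) atTop (𝓝 0) := by
    intro U hU
    obtain ⟨N, hN⟩ := hBU U hU
    exact eventually_atTop.2 ⟨N, fun n hn => hN n hn ((a' n).2 x)⟩
  rw [h1]
  change ∑' p : ℕ × (S × X), _ = a.1 x
  refine h2.tsum_prod.trans ?_
  refine tendsto_nhds_unique h3.tendsto_sum_nat ?_
  -- The partial sums telescope to `a` minus the `n`-th remainder, which tends to zero.
  have h6 : ∀ n, ∑ i ∈ Finset.range n, (spread f hf (ζ i (a' i))).1 x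
      = a.1 x - (a' n).1.1 x := fun n => by
    simp only [h4]
    exact Finset.sum_range_sub' (fun n => (a' n).1.1 x) n
  refine Tendsto.congr (fun n => (h6 n).symm) ?_
  simpa using tendsto_const_nhds.sub h5

end FormalSum

end Taut
/-! ### Extension of contramodule structures along a strongly right taut map -/

section Extension

variable {R S : Type u}
  [Ring R] [UniformSpace R] [IsUniformAddGroup R] [IsTopologicalRing R]
  [IsLinearTopology Rᵐᵒᵖ R] [T2Space R] [CompleteSpace R]
  [Ring S] [UniformSpace S] [IsUniformAddGroup S] [IsTopologicalRing S]
  [IsLinearTopology Sᵐᵒᵖ S] [T2Space S] [CompleteSpace S]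
  (f : R →+* S) (hf : Continuous f)

namespace Contra

/-- Associativity of the contraaction. The right-hand side involves only the restricted contraaction
of `R` and the `S`-module structure, which is why linear data determine the contraaction of `S`. -/
theorem act_spread (P : Contra S) (z : FormalSum R (S × P.A)) :
    P.act (FormalSum.spread f hf z) =
      P.act (FormalSum.mapCoeff f hf (FormalSum.map (fun p : S × P.A => p.1 • p.2) z)) := by
  rw [FormalSum.mapCoeff_map, FormalSum.spread, act_bind]
  simp only [act_smul, act_single]

/-- If `f` is strongly right taut and the forgetful functor is full for `R`, all `S`-linear maps
of `S`-contramodules commute with the contraactions. -/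
theorem map_act_of_isStronglyRightTaut [(forgetToModule R).Full]
    (hf : Continuous f)
    (htaut : IsStronglyRightTaut f) (hR : (𝓝 (0 : R)).IsCountablyGenerated) {P Q : Contra S}
    (g : P.A → Q.A) (hadd : ∀ x y, g (x + y) = g x + g y)
    (hsmul : ∀ (s : S) x, g (s • x) = s • g x) (a : FormalSum S P.A) :
    g (P.act a) = Q.act (FormalSum.map g a) := by
  obtain ⟨z, -, rfl⟩ := FormalSum.exists_spread_eq f hf htaut hR (isTautPair_top f) a
    fun _ => trivial
  have h := map_act_of_full (P := (restrictScalars f hf).obj P)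
    (Q := (restrictScalars f hf).obj Q) g
    (fun x y => (congrArg g (restrictScalars_add f hf P x y)).trans
      ((hadd x y).trans (restrictScalars_add f hf Q _ _).symm))
    (fun r x => (congrArg g (restrictScalars_smul f hf P r x)).trans
      ((hsmul (f r) x).trans (restrictScalars_smul f hf Q r _).symm))
    (FormalSum.map (fun p : S × P.A => p.1 • p.2) z)
  rw [act_spread, FormalSum.spread_map, act_spread, FormalSum.map_map]
  refine h.trans (congrArg ((restrictScalars f hf).obj Q).act ?_)
  refine (FormalSum.map_map _ _ _).trans ?_
  exact congrArg (fun g => FormalSum.map g z) (funext fun p => hsmul p.1 p.2)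

theorem full_forgetToModule [(forgetToModule R).Full]
    (htaut : IsStronglyRightTaut f) (hf : Continuous f)
    (hR : (𝓝 (0 : R)).IsCountablyGenerated) : (forgetToModule S).Full where
  map_surjective {P Q} g :=
    ⟨homMk (fun x => g.hom x) (map_act_of_isStronglyRightTaut f hf htaut hR (P := P) (Q := Q)
      (fun x => g.hom x) (fun x y => map_add g.hom x y) fun s x => map_smul g.hom s x), rfl⟩

/-! ### Separated `R`-contramodules with a compatible `S`-module structure -/

section

variable {f} (P : Contra R) [Module S P.A]

/-- The value in `P` of `∑ r (s, x)`, that is `∑ r (s x)`. -/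
noncomputable def spreadAct (z : FormalSum R (S × P.A)) : P.A :=
  P.act (FormalSum.map (fun p => p.1 • p.2) z)

theorem spreadAct_add (z w : FormalSum R (S × P.A)) :
    P.spreadAct (z + w) = P.spreadAct z + P.spreadAct w := by
  rw [spreadAct, FormalSum.map_add, act_add]
  rfl

theorem spreadAct_sub (z w : FormalSum R (S × P.A)) :
    P.spreadAct (z - w) = P.spreadAct z - P.spreadAct w := by
  rw [eq_sub_iff_add_eq, ← spreadAct_add, sub_add_cancel]

theorem spreadAct_sum {ι : Type*} (s : Finset ι) (z : ι → FormalSum R (S × P.A)) :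
    P.spreadAct (∑ i ∈ s, z i) = ∑ i ∈ s, P.spreadAct (z i) :=
  map_sum (AddMonoidHom.mk' P.spreadAct P.spreadAct_add) z s

theorem spreadAct_smul_single (r : R) (p : S × P.A) :
    P.spreadAct (r • FormalSum.single p) = r • p.1 • p.2 := by
  rw [spreadAct, FormalSum.map_smul, FormalSum.map_single, act_smul, act_single]

theorem spreadAct_single (p : S × P.A) : P.spreadAct (FormalSum.single p) = p.1 • p.2 := by
  rw [spreadAct, FormalSum.map_single, act_single]

theorem spreadAct_bind {X : Type u} (z : FormalSum R X) (g : X → FormalSum R (S × P.A)) :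
    P.spreadAct (FormalSum.bind z g) = P.act (FormalSum.map (fun x => P.spreadAct (g x)) z) := by
  rw [spreadAct, FormalSum.map_bind, act_bind]
  rfl

theorem spreadAct_mem {I : Submodule Rᵐᵒᵖ R} (hI : IsOpen (I : Set R))
    (z : FormalSum R (S × P.A)) (hz : ∀ p, z.1 p ∈ I) :
    P.spreadAct z ∈ contraSMul I.toAddSubgroup P :=
  ⟨_, FormalSum.map_coeff_mem I hI _ z hz, rfl⟩

/-- The map `s ↦ s x` from the free `S`-contramodule with one generator commutes with the
contraaction of `R`. -/
theorem spread_smul_eq_spreadAct [(forgetToModule R).Full]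
    (hf : Continuous f) (hcomp : ∀ (r : R) (x : P.A), f r • x = r • x)
    (z : FormalSum R (S × PUnit.{u + 1}))
    (x : P.A) : (FormalSum.spread f hf z).1 ⟨⟩ • x
      = P.act (FormalSum.map (fun p => p.1 • x) z) := by
  classical
  let F : Contra S := (formalSumMonad S).free.obj PUnit.{u + 1}
  -- No contraaction of `S` on `P` is available here. By `hcomp` this map is `R`-linear, so fullness
  -- over `R` applies to it with the restriction of `F` as source.
  let g : FormalSum S PUnit.{u + 1} → P.A := fun a => a.1 ⟨⟩ • x
  have hadd : ∀ a b : FormalSum S PUnit.{u + 1},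
      FormalSum.join (FormalSum.single a + FormalSum.single b) = a + b := fun a b => by
    rw [FormalSum.join_eq, FormalSum.add_bind, FormalSum.single_bind, FormalSum.single_bind, id,
      id]
  have hsmul : ∀ (s : S) (a : FormalSum S PUnit.{u + 1}),
      FormalSum.join (s • FormalSum.single a) = s • a := fun s a => by
    rw [FormalSum.join_eq, FormalSum.smul_bind, FormalSum.single_bind, id]
  let e : S × PUnit.{u + 1} → FormalSum S PUnit.{u + 1} := fun p => p.1 • FormalSum.single p.2
  have h := map_act_of_full (P := (restrictScalars f hf).obj F) (Q := P) g
    (fun a b => (congrArg g ((restrictScalars_add f hf F a b).trans (hadd a b))).trans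
      (add_smul (a.1 ⟨⟩ : S) (b.1 ⟨⟩) x))
    (fun r a => (congrArg g ((restrictScalars_smul f hf F r a).trans (hsmul (f r) a))).trans
      ((mul_smul (f r) (a.1 ⟨⟩ : S) x).trans (hcomp _ _)))
    (FormalSum.map e z)
  have h2 : FormalSum.join (FormalSum.mapCoeff f hf (FormalSum.map e z))
      = FormalSum.spread f hf z := by
    rw [FormalSum.mapCoeff_map, FormalSum.join_eq, FormalSum.bind_map]
    rfl
  refine (congrArg g h2).symm.trans (h.trans ?_)
  refine congrArg P.act ((FormalSum.map_map _ _ _).trans ?_)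
  refine congrArg (fun g => FormalSum.map g z) (funext fun p => ?_)
  change (p.1 • (FormalSum.single p.2 : FormalSum S PUnit.{u + 1})).1 ⟨⟩ • x = p.1 • x
  rw [FormalSum.smul_single_coeff, if_pos rfl]

/-- Lift `s` to a combination over `R` with coefficients in `I`, then evaluate at `x` by
`spread_smul_eq_spreadAct`. -/
theorem smul_mem_contraSMul_of_mem [(forgetToModule R).Full]
    (hf : Continuous f) (hcomp : ∀ (r : R) (x : P.A), f r • x = r • x)
    (htaut : IsStronglyRightTaut f)
    (hR : (𝓝 (0 : R)).IsCountablyGenerated) {I : Submodule Rᵐᵒᵖ R} {J : Submodule Sᵐᵒᵖ S}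
    (h : IsTautPair f I J) {s : S} (hs : s ∈ J) (x : P.A) :
    s • x ∈ contraSMul I.toAddSubgroup P := by
  classical
  obtain ⟨z, hz, hzs⟩ := FormalSum.exists_spread_eq f hf htaut hR h
    (s • (FormalSum.single ⟨⟩ : FormalSum S PUnit.{u + 1})) fun y => by
      rw [FormalSum.smul_single_coeff]
      split_ifs
      exacts [hs, J.zero_mem]
  have h1 := spread_smul_eq_spreadAct P hf hcomp z x
  rw [hzs, FormalSum.smul_single_coeff, if_pos rfl] at h1
  rw [h1]
  exact ⟨_, FormalSum.map_coeff_mem I h.isOpen_left _ z hz, rfl⟩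

theorem smul_mem_contraSMul [(forgetToModule R).Full]
    (hf : Continuous f) (hcomp : ∀ (r : R) (x : P.A), f r • x = r • x)
    (htaut : IsStronglyRightTaut f)
    (hR : (𝓝 (0 : R)).IsCountablyGenerated) {I : Submodule Rᵐᵒᵖ R} {J : Submodule Sᵐᵒᵖ S}
    (h : IsTautPair f I J) (s : S) {x : P.A} (hx : x ∈ contraSMul I.toAddSubgroup P) :
    s • x ∈ contraSMul I.toAddSubgroup P := by
  -- Multiplication by `s` is not known to commute with infinite sums in `P`, so `x` is first
  -- written as a finite sum of terms `r' r q` with `r` in `I`. Then `s f(r') f(r)` lies in the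
  -- two-sided ideal `J`.
  have h1 := contraSMul_le_span_of_full P I h.isOpen_left x hx
  clear hx
  induction h1 using Submodule.span_induction generalizing s with
  | mem x hx =>
    obtain ⟨r, hr, q, rfl⟩ := hx
    rw [← hcomp, ← mul_smul]
    exact smul_mem_contraSMul_of_mem P hf hcomp htaut hR h (h.mul_mem s _ (h.map_mem hr)) q
  | zero =>
    rw [smul_zero]
    exact zero_mem _
  | add x y _ _ hx hy =>
    rw [smul_add]
    exact add_mem (hx s) (hy s)
  | smul r x _ hx =>
    rw [← hcomp, ← mul_smul]
    exact hx _

theorem sum_smul_mem_contraSMul [(forgetToModule R).Full]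
    (hf : Continuous f) (hcomp : ∀ (r : R) (x : P.A), f r • x = r • x)
    (htaut : IsStronglyRightTaut f)
    (hR : (𝓝 (0 : R)).IsCountablyGenerated) {I : Submodule Rᵐᵒᵖ R} {J : Submodule Sᵐᵒᵖ S}
    (h : IsTautPair f I J) {ι : Type*} (t : Finset ι) (u : ι → S) (x : ι → P.A)
    (hu : ∀ y, (∑ i ∈ t, u i • (FormalSum.single (x i) : FormalSum S P.A)).1 y ∈ J) :
    ∑ i ∈ t, u i • x i ∈ contraSMul I.toAddSubgroup P := by
  classical
  -- The hypothesis bounds only the total coefficient of each element of `P`, so equal values of `x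
  -- i` have to be collected.
  rw [← Finset.sum_fiberwise_of_maps_to (t := t.image x) (g := x)
    fun i hi => Finset.mem_image_of_mem x hi]
  refine sum_mem fun y _ => ?_
  have h1 : ∑ i ∈ t with x i = y, u i • x i = (∑ i ∈ t with x i = y, u i) • y := by
    rw [Finset.sum_smul]
    refine Finset.sum_congr rfl fun i hi => ?_
    rw [(Finset.mem_filter.1 hi).2]
  rw [h1]
  refine smul_mem_contraSMul_of_mem P hf hcomp htaut hR h ?_ y
  have h2 := hu y
  rw [FormalSum.sum_coeff] at h2
  simp only [FormalSum.smul_single_coeff] at h2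
  rwa [Finset.sum_filter]

/-- Truncate `z` to a finite sum `w` modulo `I`. The tail has value in `I ⋌ P` and spreads to
coefficients in `J`, so the spread of `w` also has coefficients in `J`, and the finite case applies.
-/
theorem spreadAct_mem_of_spread_mem [(forgetToModule R).Full]
    (hf : Continuous f) (hcomp : ∀ (r : R) (x : P.A), f r • x = r • x)
    (htaut : IsStronglyRightTaut f)
    (hR : (𝓝 (0 : R)).IsCountablyGenerated) {I : Submodule Rᵐᵒᵖ R} {J : Submodule Sᵐᵒᵖ S}
    (h : IsTautPair f I J) (z : FormalSum R (S × P.A))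
    (hz : ∀ x, (FormalSum.spread f hf z).1 x ∈ J) :
    P.spreadAct z ∈ contraSMul I.toAddSubgroup P := by
  obtain ⟨t, ht⟩ := FormalSum.exists_finset_sub_sum_mem I h.isOpen_left z
  set w := ∑ p ∈ t, z.1 p • (FormalSum.single p : FormalSum R (S × P.A)) with hw
  rw [← sub_add_cancel z w, spreadAct_add]
  refine add_mem (P.spreadAct_mem h.isOpen_left _ ht) ?_
  have h1 : P.spreadAct w = ∑ p ∈ t, (f (z.1 p) * p.1) • p.2 := by
    rw [hw, spreadAct_sum]
    refine Finset.sum_congr rfl fun p _ => ?_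
    rw [spreadAct_smul_single, ← hcomp, ← mul_smul]
  have h2 : FormalSum.spread f hf w
      = ∑ p ∈ t, (f (z.1 p) * p.1) • (FormalSum.single p.2 : FormalSum S P.A) := by
    rw [hw, FormalSum.spread_sum]
    exact Finset.sum_congr rfl fun p _ => FormalSum.spread_smul_single f hf (z.1 p) p
  rw [h1]
  refine sum_smul_mem_contraSMul P hf hcomp htaut hR h t _ _ fun y => ?_
  rw [← h2]
  have h3 : FormalSum.spread f hf w = FormalSum.spread f hf z - FormalSum.spread f hf (z - w) := by
    rw [FormalSum.spread_sub, sub_sub_cancel]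
  rw [h3]
  exact J.sub_mem (hz y) (FormalSum.spread_coeff_mem f hf h _ ht y)

/-- The ideals occurring in taut pairs are cofinal among open right ideals, so they suffice to test
separatedness. -/
theorem eq_zero_of_forall_isTautPair (htaut : IsStronglyRightTaut f) (hP : isSeparated R P)
    {x : P.A} (hx : ∀ I J, IsTautPair f I J → x ∈ contraSMul I.toAddSubgroup P) : x = 0 := by
  refine hP x fun U hU => ?_
  obtain ⟨I, J, hIJ, hIU⟩ := htaut.exists_isTautPair (hU.mem_nhds U.zero_mem)
  obtain ⟨a, ha, hax⟩ := hx I J hIJ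
  exact ⟨a, fun p => hIU (ha p), hax⟩

/-- An `S`-module structure on a separated `R`-contramodule, compatible with the module structure
over `R`, is induced by a contraaction of `S` extending that of `R`. -/
theorem exists_extension [(forgetToModule R).Full] (htaut : IsStronglyRightTaut f)
    (hf : Continuous f) (hcomp : ∀ (r : R) (x : P.A), f r • x = r • x)
    (hR : (𝓝 (0 : R)).IsCountablyGenerated) (hP : isSeparated R P) :
    ∃ α : FormalSum S P.A → P.A, (∀ x, α (FormalSum.single x) = x) ∧
      (∀ z, α (FormalSum.join z) = α (FormalSum.map α z)) ∧
      (∀ a b, α (a + b) = α a + α b) ∧ (∀ (s : S) a, α (s • a) = s • α a) ∧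
      (∀ a, α (FormalSum.mapCoeff f hf a) = P.act a) ∧
      (∀ I J, IsTautPair f I J → ∀ a : FormalSum S P.A, (∀ x, a.1 x ∈ J) →
        α a ∈ contraSMul I.toAddSubgroup P) := by
  choose lift hlift using fun a : FormalSum S P.A =>
    (FormalSum.exists_spread_eq f hf htaut hR (isTautPair_top f) a fun _ => trivial)
  let α : FormalSum S P.A → P.A := fun a => P.spreadAct (lift a)
  -- Independence of the lift: two lifts differ by an element spreading to zero, whose value lies in
  -- every `I ⋌ P`.
  have hα : ∀ z, α (FormalSum.spread f hf z) = P.spreadAct z := fun z => by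
    refine sub_eq_zero.1 (eq_zero_of_forall_isTautPair P htaut hP fun I J hIJ => ?_)
    change P.spreadAct _ - _ ∈ _
    rw [← spreadAct_sub]
    refine spreadAct_mem_of_spread_mem P hf hcomp htaut hR hIJ _ fun x => ?_
    rw [FormalSum.spread_sub, (hlift _).2, sub_self]
    exact J.zero_mem
  have hα' : ∀ {a z}, FormalSum.spread f hf z = a → α a = P.spreadAct z := fun h => by
    rw [← h, hα]
  have hsum : ∀ a b, α (a + b) = α a + α b := fun a b => by
    rw [hα' (z := lift a + lift b) (by rw [FormalSum.spread_add, (hlift a).2, (hlift b).2]),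
      spreadAct_add]
  have hsmul_single : ∀ (s : S) x, α (s • FormalSum.single x) = s • x := fun s x =>
    (hα' (FormalSum.spread_single f hf (s, x))).trans (P.spreadAct_single (s, x))
  have hmem : ∀ I J, IsTautPair f I J → ∀ a : FormalSum S P.A, (∀ x, a.1 x ∈ J) →
      α a ∈ contraSMul I.toAddSubgroup P := fun I J hIJ a ha => by
    refine spreadAct_mem_of_spread_mem P hf hcomp htaut hR hIJ _ fun x => ?_
    rw [(hlift a).2]
    exact ha x
  -- True for finite combinations, and `a` is finite up to coefficients in `J`. Both terms of the
  -- error lie in `I ⋌ P`, because `J` is a left ideal and `I ⋌ P` is stable under `S`.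
  have hsmul : ∀ (s : S) a, α (s • a) = s • α a := fun s a => by
    refine sub_eq_zero.1 (eq_zero_of_forall_isTautPair P htaut hP fun I J hIJ => ?_)
    obtain ⟨t, ht⟩ := FormalSum.exists_finset_sub_sum_mem J hIJ.isOpen_right a
    set b := ∑ y ∈ t, a.1 y • (FormalSum.single y : FormalSum S P.A) with hb
    have hadd : ∀ (u : Finset P.A) (c : P.A → FormalSum S P.A),
        α (∑ y ∈ u, c y) = ∑ y ∈ u, α (c y) := fun u c =>
      map_sum (AddMonoidHom.mk' α hsum) c u
    have h1 : α (s • b) = s • α b := by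
      rw [hb, Finset.smul_sum, hadd, hadd, Finset.smul_sum]
      refine Finset.sum_congr rfl fun y _ => ?_
      rw [hsmul_single, smul_smul, hsmul_single, mul_smul]
    have h2 : α (s • a) - s • α a = α (s • (a - b)) - s • α (a - b) := by
      conv_lhs => rw [← sub_add_cancel a b]
      rw [smul_add, hsum, hsum, smul_add, h1, add_sub_add_right_eq_sub]
    rw [h2]
    exact sub_mem (hmem I J hIJ _ fun x => hIJ.mul_mem s _ (ht x))
      (smul_mem_contraSMul P hf hcomp htaut hR hIJ s (hmem I J hIJ _ ht))
  have hunit : ∀ x, α (FormalSum.single x) = x := fun x => by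
    have := hsmul_single 1 x
    rwa [one_smul, one_smul] at this
  refine ⟨α, hunit, fun w => ?_, hsum, hsmul, fun a => ?_, hmem⟩
  · obtain ⟨z, -, rfl⟩ := FormalSum.exists_spread_eq f hf htaut hR (isTautPair_top f) w
      fun _ => trivial
    -- A lift of the opened parentheses, obtained by lifting each `s • a` separately. Associativity
    -- over `R` then reduces the claim to the `S`-linearity of `α`.
    have h1 : FormalSum.join (FormalSum.spread f hf z)
        = FormalSum.spread f hf (FormalSum.bind z fun p => lift (p.1 • p.2)) := by
      rw [FormalSum.spread_bind, FormalSum.join_eq, FormalSum.spread, FormalSum.bind_bind]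
      simp only [FormalSum.smul_bind, FormalSum.single_bind, (hlift _).2, id]
    rw [hα' h1.symm, spreadAct_bind, FormalSum.spread_map, hα, spreadAct, FormalSum.map_map]
    exact congrArg P.act (congrArg (fun g => FormalSum.map g z) (funext fun p => hsmul p.1 p.2))
  · have h1 : FormalSum.spread f hf (FormalSum.map (fun x => ((1 : S), x)) a)
        = FormalSum.mapCoeff f hf a := by
      rw [FormalSum.spread, FormalSum.mapCoeff_map, FormalSum.bind_map]
      simp only [one_smul, FormalSum.bind_single]
    rw [hα' h1, spreadAct, FormalSum.map_map]
    simp only [one_smul]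
    rw [FormalSum.map_eq, FormalSum.bind_single]

end

end Contra

end Extension
/-! ### The pseudopullback square -/

section Main

variable {R S : Type u}
  [Ring R] [UniformSpace R] [IsUniformAddGroup R] [IsTopologicalRing R]
  [IsLinearTopology Rᵐᵒᵖ R] [T2Space R] [CompleteSpace R]
  [Ring S] [UniformSpace S] [IsUniformAddGroup S] [IsTopologicalRing S]
  [IsLinearTopology Sᵐᵒᵖ S] [T2Space S] [CompleteSpace S]
  {f : R →+* S}

/-- An `S`-module whose underlying `R`-module is that of a separated `R`-contramodule `P` is the
underlying module of a separated `S`-contramodule restricting to `P`. -/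
theorem Separ.exists_iso_of_linearEquiv [(Contra.forgetToModule R).Full]
    (htaut : IsStronglyRightTaut f) (hf : Continuous f)
    (hR : (𝓝 (0 : R)).IsCountablyGenerated) (M : ModuleCat.{u} S) (P : Separ R)
    (e : M ≃+ P.obj.A) (he : ∀ (r : R) (m : M), e (f r • m) = r • e m) :
    ∃ (Q : Separ S) (i : (Separ.forgetToModule S).obj Q ≅ M)
      (j : (Separ.restrictScalars f hf).obj Q ≅ P), ∀ x, e (i.hom.hom x) = j.hom.hom.f x := by
  -- The `S`-action of `M`, transported along `e`.
  let _ : Module S P.obj.A :=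
    { smul := fun s p => e (s • e.symm p)
      one_smul := fun p => by
        change e ((1 : S) • e.symm p) = p
        rw [one_smul, e.apply_symm_apply]
      mul_smul := fun s t p => by
        change e ((s * t) • e.symm p) = e (s • e.symm (e (t • e.symm p)))
        rw [e.symm_apply_apply, mul_smul]
      smul_zero := fun s => by
        change e (s • e.symm 0) = 0
        rw [map_zero, smul_zero, map_zero]
      smul_add := fun s p q => by
        change e (s • e.symm (p + q)) = e (s • e.symm p) + e (s • e.symm q)
        rw [map_add, smul_add, map_add]
      add_smul := fun s t p => by
        change e ((s + t) • e.symm p) = e (s • e.symm p) + e (t • e.symm p)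
        rw [add_smul, map_add]
      zero_smul := fun p => by
        change e ((0 : S) • e.symm p) = 0
        rw [zero_smul, map_zero] }
  have hsm : ∀ (s : S) (p : P.obj.A), s • p = e (s • e.symm p) := fun _ _ => rfl
  obtain ⟨α, hunit, hassoc, hadd, hsmul, hact, hmem⟩ :=
    Contra.exists_extension P.obj htaut hf
      (fun r p => by rw [hsm, he, e.apply_symm_apply]) hR P.property
  let Q : Contra S := Contra.ofAct P.obj.A α hunit hassoc
  have hQadd : ∀ x y : P.obj.A, α (FormalSum.single x + FormalSum.single y) = x + y :=
    fun x y => by rw [hadd, hunit, hunit]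
  have hQsmul : ∀ (s : S) (x : P.obj.A), α (s • FormalSum.single x) = s • x :=
    fun s x => by rw [hsmul, hunit]
  have hQzero : α 0 = 0 := by
    have := hadd 0 0
    rwa [add_zero, left_eq_add] at this
  have hQ : Contra.isSeparated S Q := by
    intro p hp
    -- The zero of `Q` is by definition `α 0`, which has to be identified with the zero of `P`.
    refine Eq.trans ?_ hQzero.symm
    refine Contra.eq_zero_of_forall_isTautPair P.obj htaut P.property fun I J hIJ => ?_
    obtain ⟨a, ha, hap⟩ := hp J hIJ.isOpen_right
    rw [← hap]
    exact hmem I J hIJ a ha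
  let i : (Contra.forgetToModule S).obj Q ≅ M := LinearEquiv.toModuleIso
    { e.symm.toEquiv with
      map_add' := fun x y => (congrArg e.symm (hQadd x y)).trans (map_add e.symm _ _)
      map_smul' := fun s x => (congrArg e.symm (hQsmul s x)).trans (e.symm_apply_apply _) }
  have hj : ∀ a : FormalSum R P.obj.A,
      P.obj.act (FormalSum.map id a) = α (FormalSum.mapCoeff f hf a) := fun a => by
    rw [hact, FormalSum.map_eq]
    exact congrArg P.obj.act (FormalSum.bind_single a)
  let j : (Contra.restrictScalars f hf).obj Q ≅ P.obj :=
    Monad.Algebra.isoMk (Iso.refl _) (ConcreteCategory.hom_ext _ _ hj)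
  exact ⟨⟨Q, hQ⟩, i, (Contra.isSeparated R).isoMk j, fun x => e.apply_symm_apply x⟩

theorem Separ.isPseudopullback_squareIso [(Contra.forgetToModule R).Full]
    (htaut : IsStronglyRightTaut f) (hf : Continuous f)
    (hR : (𝓝 (0 : R)).IsCountablyGenerated) : IsPseudopullback (Separ.squareIso f hf) := by
  have := Contra.full_forgetToModule f htaut hf hR
  have := Contra.faithful_forgetToModule (R := S)
  refine { faithful := ⟨?_⟩, full := ⟨?_⟩, essSurj := ⟨?_⟩ }
  · intro P Q g h hgh
    exact (Separ.forgetToModule S).map_injective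
      (congrArg Limits.CategoricalPullback.Hom.fst hgh)
  · intro P Q h
    obtain ⟨k, hk⟩ := (Separ.forgetToModule S).map_surjective h.fst
    refine ⟨k, Limits.CategoricalPullback.hom_ext hk ?_⟩
    -- The structure isomorphisms of the square are identities on underlying sets, so the
    -- compatibility `h.w` forces the second component to be the same map of sets as the first.
    refine ObjectProperty.hom_ext _
      (Monad.Algebra.Hom.ext (ConcreteCategory.hom_ext _ _ fun x => ?_))
    exact (ConcreteCategory.congr_hom hk x).trans (ConcreteCategory.congr_hom h.w x)
  · rintro ⟨M, P, φ⟩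
    obtain ⟨Q, i, j, hij⟩ := Separ.exists_iso_of_linearEquiv htaut hf hR M P
      φ.toLinearEquiv.toAddEquiv fun r m => φ.toLinearEquiv.map_smul r m
    exact ⟨Q, ⟨Limits.CategoricalPullback.mkIso i j (ModuleCat.hom_ext (LinearMap.ext hij))⟩⟩

end Main

theorem mainTheorem7 {R S : Type u}
    [Ring R] [UniformSpace R] [IsUniformAddGroup R] [IsTopologicalRing R]
    [IsLinearTopology R R] [IsLinearTopology Rᵐᵒᵖ R] [T2Space R] [CompleteSpace R]
    [Ring S] [UniformSpace S] [IsUniformAddGroup S] [IsTopologicalRing S]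
    [IsLinearTopology S S] [IsLinearTopology Sᵐᵒᵖ S] [T2Space S] [CompleteSpace S]
    (hR : (𝓝 (0 : R)).IsCountablyGenerated) (hS : (𝓝 (0 : S)).IsCountablyGenerated)
    (f : R →+* S) (hf : Continuous f) (htaut : IsStronglyRightTaut f)
    (hfull : (Contra.forgetToModule R).Full ∧ (Contra.forgetToModule R).Faithful) :
    IsPseudopullback (Separ.squareIso f hf) ∧
      ((Separ.forgetToModule S).Full ∧ (Separ.forgetToModule S).Faithful) ∧
      ((Separ.forgetToModule R).Full ∧ (Separ.forgetToModule R).Faithful) ∧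
      ((Contra.forgetToModule S).Full ∧ (Contra.forgetToModule S).Faithful) := by
  have := hfull.1
  have := hfull.2
  have := Contra.full_forgetToModule f htaut hf hR
  have := Contra.faithful_forgetToModule (R := S)
  exact ⟨Separ.isPseudopullback_squareIso htaut hf hR, ⟨inferInstance, inferInstance⟩,
    ⟨inferInstance, inferInstance⟩, inferInstance, inferInstance⟩
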